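/- Consider a stable marriage instance with a set $M$ of $n$ men and a set $W$ of $n$ women. A preference profile $\succ$ gives every man $m$ a strict total order $\succ_m$ on all of $W$ and every woman $w$ a strict total order $\succ_w$ on all of $M$. Let $\mathrm{DA}(\succ)$ denote the matching computed by the men-proposing deferred acceptance algorithm: in each round every currently unmatched man proposes to his favorite woman among those who have not rejected him yet, and every woman then tentatively keeps her favorite among her new proposers and the man she currently holds and rejects the rest; the algorithm stops when no further proposals can be made. For a matching $\mu$ we write $\mu(a)$ for the partner of the agent $a$. Let $\succ$ be a profile, $\mu := \mathrm{DA}(\succ)$, and let $m\in M$ and $w\in W$ be fixed. Let $\widehat{\succ}_m$ be the list obtained from $\succ_m$ by moving $\mu(m)$ to the top position and changing nothing else; for $w'\neq\mu(m)$ let $\widehat{\succ}_m^{\,w'\uparrow}$ be the list obtained from $\widehat{\succ}_m$ by moving $w'$ to the top position; and put $$S_m := \{\widehat{\succ}_m\}\cup\{\widehat{\succ}_m^{\,w'\uparrow} : w'\in W,\ w'\neq\mu(m)\}.$$ **Lemma.** Let $\succ'_w$ be any strict total order on $M$ and $\succ'_m$ any strict total order on $W$, and let $\mu' := \mathrm{DA}(\succ_{-\{m,w\}},\succ'_m,\succ'_w)$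 be the outcome when $m$ and $w$ report these lists and all other agents report their lists in $\succ$. If $\mu'(m)=\mu(m)$, then there is a list $\succ''_m\in S_m$ such that the matching $\mu'' := \mathrm{DA}(\succ_{-\{m,w\}},\succ''_m,\succ'_w)$ satisfies $\mu''(m)=\mu(m)$ and $\mu''(w)=\mu'(w)$. -/

import Mathlib

/-- A preference list over `α`: a strict total order, `L.rel a b` meaning that `a` is
strictly preferred to `b`. -/
structure PrefList (α : Type*) where
  rel : α → α → Prop
  irrefl : ∀ a, ¬ rel a a
  trans : ∀ a b c, rel a b → rel b c → rel a c
  total : ∀ a b, a ≠ b → rel a b ∨ rel b a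

namespace PrefList

/-- The list obtained by moving `x` to the top position and changing nothing else. -/
def toTop {α : Type*} (L : PrefList α) (x : α) : PrefList α where
  rel a b := b ≠ x ∧ (a = x ∨ L.rel a b)
  irrefl := by
    rintro a ⟨h, h' | h'⟩
    · exact h h'
    · exact L.irrefl a h'
  trans := by
    rintro a b c ⟨hb, hab⟩ ⟨hc, hbc⟩
    refine ⟨hc, hab.imp_right fun hab => ?_⟩
    rcases hbc with hbc | hbc
    · exact absurd hbc hb
    · exact L.trans a b c hab hbc
  total := by
    intro a b hab
    by_cases ha : a = x
    · exact Or.inl ⟨fun hb => hab (ha.trans hb.symm), Or.inl ha⟩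
    · by_cases hb : b = x
      · exact Or.inr ⟨ha, Or.inl hb⟩
      · exact (L.total a b hab).imp (fun h => ⟨hb, Or.inr h⟩) (fun h => ⟨ha, Or.inr h⟩)

theorem exists_favorite {α : Type*} (L : PrefList α) (s : Finset α) (hs : s.Nonempty) :
    ∃ a ∈ s, ∀ b ∈ s, b ≠ a → L.rel a b := by
  induction hs using Finset.Nonempty.cons_induction with
  | singleton a =>
    exact ⟨a, by simp, fun b hb hba => absurd (Finset.mem_singleton.1 hb) hba⟩
  | cons a s ha _ ih =>
    obtain ⟨c, hc, hmax⟩ := ih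
    have hac : a ≠ c := fun h => ha (h ▸ hc)
    rcases L.total a c hac with h | h
    · refine ⟨a, by simp, fun b hb hba => ?_⟩
      rcases Finset.mem_cons.1 hb with rfl | hb
      · exact absurd rfl hba
      · by_cases hbc : b = c
        · exact hbc ▸ h
        · exact L.trans a c b h (hmax b hb hbc)
    · refine ⟨c, by simp [hc], fun b hb hbc => ?_⟩
      rcases Finset.mem_cons.1 hb with rfl | hb
      · exact h
      · exact hmax b hb hbc

open Classical in
/-- The favorite element of a finite set according to `L`; `none` if the set is empty. -/
noncomputable def favorite {α : Type*} (L : PrefList α) (s : Finset α) : Option α :=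
  if hs : s.Nonempty then some (L.exists_favorite s hs).choose else none

theorem favorite_eq_none {α : Type*} (L : PrefList α) (s : Finset α) :
    L.favorite s = none ↔ s = ∅ := by
  unfold favorite
  split_ifs with h
  · simp [h.ne_empty]
  · simpa using Finset.not_nonempty_iff_eq_empty.1 h

theorem favorite_eq_some {α : Type*} (L : PrefList α) (s : Finset α) (a : α) :
    L.favorite s = some a ↔ a ∈ s ∧ ∀ b ∈ s, b ≠ a → L.rel a b := by
  unfold favorite
  split_ifs with h
  · have hc := (L.exists_favorite s h).choose_spec
    constructor
    · intro he
      rw [← Option.some.inj he]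
      exact hc
    · rintro ⟨ha, hm⟩
      congr 1
      by_contra hne
      exact L.irrefl a (L.trans _ _ _ (hm _ hc.1 hne) (hc.2 a ha (Ne.symm hne)))
  · simp only [false_iff]
    rintro ⟨ha, -⟩
    exact h ⟨a, ha⟩

end PrefList

/-- A preference profile for the men `M` and the women `W`. -/
structure Profile (M W : Type*) where
  men : M → PrefList W
  women : W → PrefList M

namespace Profile

/-- Replace the list of the man `m` by `L`. -/
def setMan {M W : Type*} [DecidableEq M] (P : Profile M W) (m : M) (L : PrefList W) :
    Profile M W where
  men := Function.update P.men m L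
  women := P.women

/-- Replace the list of the woman `w` by `L`. -/
def setWoman {M W : Type*} [DecidableEq W] (P : Profile M W) (w : W) (L : PrefList M) :
    Profile M W where
  men := P.men
  women := Function.update P.women w L

end Profile

/-- A state of the deferred acceptance algorithm: the man that each woman tentatively
holds, and the set of women who have rejected each man so far. -/
structure DAState (M W : Type*) where
  holds : W → Option M
  rejectedBy : M → Finset W

namespace DAState

/-- At the start nobody is held and nobody has been rejected. -/
def init (M W : Type*) : DAState M W where
  holds _ := none
  rejectedBy _ := ∅

open Classical in
/-- Proposal phase: a man who is currently unmatched proposes to his favorite woman among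
those who have not rejected him yet; a matched man makes no proposal. -/
noncomputable def proposal {M W : Type*} [Fintype W] (P : Profile M W) (s : DAState M W)
    (m : M) : Option W :=
  if ∃ w, s.holds w = some m then none
  else (P.men m).favorite (Finset.univ.filter fun w => w ∉ s.rejectedBy m)

open Classical in
/-- The men a woman chooses among in a rejection phase: the man she holds, if any, and
all men who have just proposed to her. -/
noncomputable def suitors {M W : Type*} [Fintype M] [Fintype W] (P : Profile M W)
    (s : DAState M W) (w : W) : Finset M :=
  Finset.univ.filter fun m => s.holds w = some m ∨ s.proposal P m = some w

open Classical in
/-- One round: the unmatched men propose, each woman tentatively accepts her favorite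
suitor and rejects the others. -/
noncomputable def step {M W : Type*} [Fintype M] [Fintype W] (P : Profile M W)
    (s : DAState M W) : DAState M W where
  holds w := (P.women w).favorite (s.suitors P w)
  rejectedBy m := s.rejectedBy m ∪ Finset.univ.filter fun w =>
    m ∈ s.suitors P w ∧ (P.women w).favorite (s.suitors P w) ≠ some m

/-- No further proposals can be made. -/
def Terminal {M W : Type*} [Fintype W] (P : Profile M W) (s : DAState M W) : Prop :=
  ∀ m, s.proposal P m = none

/-- Invariants of the algorithm, used to show that it stops and outputs a matching. -/
structure Valid {M W : Type*} (s : DAState M W) : Prop where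
  not_rejected : ∀ m w, s.holds w = some m → w ∉ s.rejectedBy m
  inj : ∀ m w w', s.holds w = some m → s.holds w' = some m → w = w'
  holds_of_rejected : ∀ m w, w ∈ s.rejectedBy m → s.holds w ≠ none

theorem valid_init (M W : Type*) : (init M W).Valid := by
  constructor <;> simp [init]

section

variable {M W : Type*} [Fintype M] [Fintype W] (P : Profile M W) (s : DAState M W)

theorem mem_suitors (m : M) (w : W) :
    m ∈ s.suitors P w ↔ s.holds w = some m ∨ s.proposal P m = some w := by
  simp [suitors]

theorem not_held_of_proposal {m : M} {w : W} (h : s.proposal P m = some w) (w' : W) :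
    s.holds w' ≠ some m := by
  intro h'
  have hex : ∃ w, s.holds w = some m := ⟨w', h'⟩
  simp [proposal, hex] at h

theorem not_rejected_of_proposal {m : M} {w : W} (h : s.proposal P m = some w) :
    w ∉ s.rejectedBy m := by
  unfold proposal at h
  split_ifs at h
  rw [PrefList.favorite_eq_some] at h
  simpa using h.1

variable {s}

theorem Valid.not_rejected_of_suitor (hs : s.Valid) {m : M} {w : W}
    (h : m ∈ s.suitors P w) : w ∉ s.rejectedBy m := by
  rcases (mem_suitors P s m w).1 h with h | h
  · exact hs.not_rejected m w h
  · exact not_rejected_of_proposal P s h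

theorem Valid.suitor_unique (hs : s.Valid) {m : M} {w w' : W}
    (h : m ∈ s.suitors P w) (h' : m ∈ s.suitors P w') : w = w' := by
  rcases (mem_suitors P s m w).1 h with h | h <;>
    rcases (mem_suitors P s m w').1 h' with h' | h'
  · exact hs.inj m w w' h h'
  · exact absurd h (not_held_of_proposal P s h' w)
  · exact absurd h' (not_held_of_proposal P s h w')
  · exact Option.some.inj (h.symm.trans h')

theorem suitor_of_step_holds {m : M} {w : W} (h : (s.step P).holds w = some m) :
    m ∈ s.suitors P w :=
  (((P.women w).favorite_eq_some _ _).1 h).1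

theorem step_holds_of_suitor {m : M} {w : W} (h : m ∈ s.suitors P w) :
    (s.step P).holds w ≠ none := by
  intro h'
  have h0 := ((P.women w).favorite_eq_none _).1 h'
  rw [h0] at h
  simp at h

theorem mem_step_rejectedBy (m : M) (w : W) : w ∈ (s.step P).rejectedBy m ↔
    w ∈ s.rejectedBy m ∨ (m ∈ s.suitors P w ∧ (s.step P).holds w ≠ some m) := by
  simp [step]

theorem Valid.step (hs : s.Valid) : (s.step P).Valid where
  not_rejected m w h hr := by
    rcases (mem_step_rejectedBy P m w).1 hr with hr | hr
    · exact hs.not_rejected_of_suitor P (suitor_of_step_holds P h) hr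
    · exact hr.2 h
  inj m w w' h h' :=
    hs.suitor_unique P (suitor_of_step_holds P h) (suitor_of_step_holds P h')
  holds_of_rejected m w hr := by
    rcases (mem_step_rejectedBy P m w).1 hr with hr | hr
    · obtain ⟨m', hm'⟩ := Option.ne_none_iff_exists'.1 (hs.holds_of_rejected m w hr)
      exact step_holds_of_suitor P ((mem_suitors P s m' w).2 (Or.inl hm'))
    · exact step_holds_of_suitor P hr.1

variable (s) in
open Classical in
/-- Progress of a man: each rejection counts two, being held counts one. -/
noncomputable def progress (m : M) : ℕ :=
  2 * (s.rejectedBy m).card + if ∃ w, s.holds w = some m then 1 else 0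

variable (s) in
theorem progress_le (m : M) : s.progress m ≤ 2 * Fintype.card W + 1 := by
  unfold progress
  have := Finset.card_le_univ (s.rejectedBy m)
  split_ifs <;> omega

theorem card_rejectedBy_le (m : M) :
    (s.rejectedBy m).card ≤ ((s.step P).rejectedBy m).card :=
  Finset.card_le_card fun w hw => (mem_step_rejectedBy P m w).2 (Or.inl hw)

theorem Valid.suitor_progress (hs : s.Valid) {m : M} {w : W} (h : m ∈ s.suitors P w) :
    (∃ w, (s.step P).holds w = some m) ∨
      (s.rejectedBy m).card < ((s.step P).rejectedBy m).card := by
  by_cases hh : (s.step P).holds w = some m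
  · exact Or.inl ⟨w, hh⟩
  · refine Or.inr (Finset.card_lt_card ?_)
    rw [Finset.ssubset_iff_of_subset
      fun w hw => (mem_step_rejectedBy P m w).2 (Or.inl hw)]
    exact ⟨w, (mem_step_rejectedBy P m w).2 (Or.inr ⟨h, hh⟩),
      hs.not_rejected_of_suitor P h⟩

theorem Valid.progress_mono (hs : s.Valid) (m : M) :
    s.progress m ≤ (s.step P).progress m := by
  have hc := card_rejectedBy_le (s := s) P m
  unfold progress
  by_cases h : ∃ w, s.holds w = some m
  · obtain ⟨w, hw⟩ := h
    rcases hs.suitor_progress P ((mem_suitors P s m w).2 (Or.inl hw)) with h' | h'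
    · rw [if_pos h']
      split_ifs <;> omega
    · split_ifs <;> omega
  · rw [if_neg h]
    split_ifs <;> omega

theorem Valid.progress_lt (hs : s.Valid) {m : M} {w : W} (h : s.proposal P m = some w) :
    s.progress m < (s.step P).progress m := by
  have hc := card_rejectedBy_le (s := s) P m
  have hn : ¬ ∃ w, s.holds w = some m := fun ⟨w', h'⟩ => not_held_of_proposal P s h w' h'
  unfold progress
  rw [if_neg hn]
  rcases hs.suitor_progress P ((mem_suitors P s m w).2 (Or.inr h)) with h' | h'
  · rw [if_pos h']
    omega
  · split_ifs <;> omega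

end

section

variable {M W : Type*} [Fintype M] [Fintype W] (P : Profile M W)

theorem valid_iterate (k : ℕ) : ((step P)^[k] (init M W)).Valid := by
  induction k with
  | zero => exact valid_init M W
  | succ k ih =>
    rw [Function.iterate_succ_apply']
    exact ih.step P

theorem exists_terminal : ∃ k, ((step P)^[k] (init M W)).Terminal P := by
  by_contra hno
  have key : ∀ k, k ≤ ∑ m, ((step P)^[k] (init M W)).progress m := by
    intro k
    induction k with
    | zero => exact Nat.zero_le _
    | succ k ih =>
      have hk : ¬ ((step P)^[k] (init M W)).Terminal P := fun h => hno ⟨k, h⟩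
      simp only [Terminal, not_forall] at hk
      obtain ⟨m, hm⟩ := hk
      obtain ⟨w, hw⟩ := Option.ne_none_iff_exists'.1 hm
      rw [Function.iterate_succ_apply']
      exact Nat.succ_le_of_lt (lt_of_le_of_lt ih (Finset.sum_lt_sum
        (fun m _ => (valid_iterate P k).progress_mono P m)
        ⟨m, Finset.mem_univ m, (valid_iterate P k).progress_lt P hw⟩))
  have hle : ∀ k, ∑ m, ((step P)^[k] (init M W)).progress m ≤
      ∑ _m : M, (2 * Fintype.card W + 1) :=
    fun k => Finset.sum_le_sum fun m _ => progress_le _ m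
  have h1 := (key (∑ _m : M, (2 * Fintype.card W + 1) + 1)).trans (hle _)
  omega

open Classical in
/-- The state in which the algorithm terminates: the state after the first round from which
no further proposals can be made. -/
noncomputable def final : DAState M W :=
  (step P)^[Nat.find (exists_terminal P)] (init M W)

theorem final_terminal : (final P).Terminal P := by
  classical
  exact Nat.find_spec (exists_terminal P)

theorem final_valid : (final P).Valid :=
  valid_iterate P _

/-- With equally many men and women, every man is held at the end. -/
theorem final_held (hcard : Fintype.card M = Fintype.card W) (m : M) :
    ∃ w, (final P).holds w = some m := by
  classical
  by_contra hm
  have hp := final_terminal P m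
  unfold proposal at hp
  rw [if_neg hm, PrefList.favorite_eq_none] at hp
  have hr : ∀ w, w ∈ (final P).rejectedBy m := by
    intro w
    by_contra hw
    have : w ∈ Finset.univ.filter fun w => w ∉ (final P).rejectedBy m := by simp [hw]
    exact absurd (hp ▸ this) (Finset.notMem_empty w)
  have hex : ∀ w, ∃ m', (final P).holds w = some m' := fun w =>
    Option.ne_none_iff_exists'.1 ((final_valid P).holds_of_rejected m w (hr w))
  choose f hf using hex
  have hinj : Function.Injective f := fun w w' h =>
    (final_valid P).inj (f w) w w' (hf w) (h ▸ hf w')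
  obtain ⟨w, hw⟩ :=
    ((Fintype.bijective_iff_injective_and_card f).2 ⟨hinj, hcard.symm⟩).2 m
  exact hm ⟨w, hw ▸ hf w⟩

end

end DAState

/-- The matching computed by the men-proposing deferred acceptance algorithm, as a bijection
`μ` from the men to the women: `μ m` is the partner of the man `m`, namely the woman who
holds `m` when the algorithm terminates, and `μ.symm w` is the partner of the woman `w`. -/
noncomputable def DA {M W : Type*} [Fintype M] [Fintype W]
    (hcard : Fintype.card M = Fintype.card W) (P : Profile M W) : M ≃ W :=
  Equiv.ofBijective (fun m => (DAState.final_held P hcard m).choose)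
    ((Fintype.bijective_iff_injective_and_card _).2 ⟨fun m m' h => by
      have h1 := (DAState.final_held P hcard m).choose_spec
      have h2 := (DAState.final_held P hcard m').choose_spec
      simp only at h
      rw [h] at h1
      exact Option.some.inj (h1.symm.trans h2), hcard⟩)

/-- The list of the man `m` with his deferred acceptance partner promoted to the top. -/
noncomputable def partnerToTop {M W : Type*} [Fintype M] [Fintype W]
    (hcard : Fintype.card M = Fintype.card W) (P : Profile M W) (m : M) : PrefList W :=
  (P.men m).toTop (DA hcard P m)

/-- The set `S_m`: the list of `m` with his partner `μ m` promoted to the top, together with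
all lists obtained from that list by pushing one woman other than `μ m` to the top. -/
noncomputable def accompliceLists {M W : Type*} [Fintype M] [Fintype W]
    (hcard : Fintype.card M = Fintype.card W) (P : Profile M W) (m : M) : Set (PrefList W) :=
  {partnerToTop hcard P m} ∪
    {L | ∃ w', w' ≠ DA hcard P m ∧ L = (partnerToTop hcard P m).toTop w'}

/-! Fix the report of `w`, let `u` be the partner of `m`, and let `L` be the report of `m`. The
candidates are the list with `u` on top and, for each `x` above `u` in `L`, the list starting with
`x`, `u`.

Each candidate still gives `u` to `m`: the outcome of `L` stays stable, so by optimality `m` gets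
`u` or `x`, and `DA_setMan_ne_of_top` excludes `x`. The reason is a count: if `m` proposes to all
women above `u`, they all reject him and some woman gets no proposal, whereas in a run giving him
`x` every woman gets one.

Every other man gets from `L` the worst of his partners over the candidates (`exists_DA_setMan_eq`),
so some candidate reproduces the partner of `w`. He gets nothing better from `L` than from any
candidate, because the outcome of `L` is stable for each of them. He gets nothing worse than all of
them, because the pooled proposals of the candidates form a closed relation for `L`, and deferred
acceptance never leaves a closed relation. -/

namespace PrefList

variable {α : Type*}

theorem asymm (L : PrefList α) {a b : α} (h : L.rel a b) : ¬ L.rel b a :=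
  fun h' => L.irrefl a (L.trans a b a h h')

/-- The list in the opposite order. -/
def reverse (L : PrefList α) : PrefList α where
  rel a b := L.rel b a
  irrefl := L.irrefl
  trans a b c h h' := L.trans c b a h' h
  total a b h := (L.total a b h).symm

end PrefList

/-! ### Stable matchings and closed relations -/

namespace Profile

variable {M W : Type*}

/-- A perfect matching without blocking pairs. -/
def Stable (P : Profile M W) (μ : M ≃ W) : Prop :=
  ∀ a b, (P.men a).rel b (μ a) → (P.women b).rel (μ.symm b) a

/-- `S` contains every proposal that the men have to make once all their better proposals
have been rejected in favor of other proposals in `S`. -/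
def Closed (P : Profile M W) (S : M → W → Prop) : Prop :=
  ∀ a b, (∀ c, (P.men a).rel c b → ∃ a', S a' c ∧ (P.women c).rel a' a) → S a b

section setMan

variable [DecidableEq M] (P : Profile M W) (m : M) (L : PrefList W)

@[simp]
theorem setMan_women : (P.setMan m L).women = P.women := rfl

@[simp]
theorem setMan_men_self : (P.setMan m L).men m = L := by simp [setMan]

theorem setMan_men_of_ne {a : M} (h : a ≠ m) : (P.setMan m L).men a = P.men a := by
  simp [setMan, h]

variable {P m L}

/-- Stability persists if the man `m` has no new women above his partner. -/
theorem Stable.setMan {L' : PrefList W} {μ : M ≃ W} (h : (P.setMan m L).Stable μ)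
    (hL : ∀ c, L'.rel c (μ m) → L.rel c (μ m)) : (P.setMan m L').Stable μ := by
  intro a b hab
  refine h a b ?_
  by_cases ha : a = m
  · subst ha
    simp only [setMan_men_self] at hab ⊢
    exact hL b hab
  · rwa [setMan_men_of_ne _ _ _ ha] at hab ⊢

end setMan

variable {P : Profile M W}

/-- To go below his partner a man must lose her to a rival who likes her at least as much as his own
partner; such a rival would block `μ`. -/
theorem Stable.closed {μ : M ≃ W} (h : P.Stable μ) :
    P.Closed fun a b => b = μ a ∨ (P.men a).rel b (μ a) := by
  intro a b hab
  by_contra hb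
  rw [not_or] at hb
  obtain ⟨a', ha', hr⟩ := hab _ (((P.men a).total _ _ hb.1).resolve_left hb.2)
  rcases ha' with ha' | ha'
  · rw [← μ.injective ha'] at hr
    exact (P.women _).irrefl _ hr
  · have := h _ _ ha'
    rw [Equiv.symm_apply_apply] at this
    exact (P.women _).asymm hr this

/-- If a man prefers his partner in one stable matching to that in another one, then the
partner in the latter has the opposite preference. -/
theorem Stable.decomposition [Finite M] {σ τ : M ≃ W} (hσ : P.Stable σ) (hτ : P.Stable τ)
    {a : M} (ha : (P.men a).rel (τ a) (σ a)) :
    (P.women (σ a)).rel a (τ.symm (σ a)) := by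
  have hstep : ∀ a, (P.men a).rel (τ a) (σ a) →
      (P.women (τ a)).rel (σ.symm (τ a)) a := fun a h => hσ a _ h
  let g : Equiv.Perm M := τ.trans σ.symm
  have hg : Set.MapsTo g {a | (P.men a).rel (τ a) (σ a)}
      {a | (P.men a).rel (τ a) (σ a)} := by
    intro a h
    have h1 := hstep a h
    have hσg : σ (g a) = τ a := by simp [g]
    have hg' : σ.symm (τ a) = g a := rfl
    rw [hg'] at h1
    simp only [Set.mem_ofPred_eq]
    rw [hσg]
    have hne : τ (g a) ≠ τ a := by
      intro he
      rw [τ.injective he] at h1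
      exact (P.women _).irrefl _ h1
    refine ((P.men _).total _ _ hne).resolve_right fun h2 => ?_
    have h3 := hτ _ _ h2
    rw [Equiv.symm_apply_apply] at h3
    exact (P.women _).asymm h1 h3
  -- By finiteness `g` permutes the men preferring `τ`, so the `τ`-partner of `σ a` is one of them
  -- and `hstep` applies to him.
  have hsurj := Equiv.Perm.perm_symm_mapsTo_of_mapsTo g hg ha
  have h1 := hstep _ hsurj
  have he : τ (g.symm a) = σ a := by
    have : g (g.symm a) = a := by simp
    have h2 : σ (g (g.symm a)) = τ (g.symm a) := by simp [g]
    rw [← h2, this]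
  rw [he, Equiv.symm_apply_apply] at h1
  rwa [← he, Equiv.symm_apply_apply, he]

end Profile

/-! ### Lower and upper bounds on the proposals made in a run -/

namespace DAState

theorem rejected_of_proposal {M W : Type*} [Fintype W] (P : Profile M W) {s : DAState M W}
    {a : M} {b c : W}
    (h : s.proposal P a = some b) (hc : (P.men a).rel c b) : c ∈ s.rejectedBy a := by
  unfold proposal at h
  split_ifs at h
  rw [PrefList.favorite_eq_some] at h
  by_contra hcr
  have hcb : c ≠ b := fun he => (P.men a).irrefl b (he ▸ hc)
  exact (P.men a).asymm hc (h.2 c (by simpa using hcr) hcb)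

variable {M W : Type*} [Fintype M] [Fintype W] (P : Profile M W)

theorem exists_step_holds_of_suitor {s : DAState M W} {a : M} {b : W}
    (h : a ∈ s.suitors P b) :
    ∃ a' ∈ s.suitors P b, (s.step P).holds b = some a' ∧
      (a ≠ a' → (P.women b).rel a' a) := by
  obtain ⟨a', ha'⟩ := Option.ne_none_iff_exists'.1 (step_holds_of_suitor P h)
  exact ⟨a', suitor_of_step_holds P ha', ha',
    (((P.women b).favorite_eq_some _ _).1 ha').2 a h⟩

/-- Women only improve, and men are held below the women who rejected them. -/
theorem iterate_sound (k : ℕ) :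
    (∀ a b, b ∈ ((step P)^[k] (init M W)).rejectedBy a →
      ∃ a', ((step P)^[k] (init M W)).holds b = some a' ∧ (P.women b).rel a' a) ∧
    (∀ a b c, ((step P)^[k] (init M W)).holds b = some a → (P.men a).rel c b →
      c ∈ ((step P)^[k] (init M W)).rejectedBy a) := by
  induction k with
  | zero => simp [init]
  | succ k ih =>
    rw [Function.iterate_succ_apply']
    set s := (step P)^[k] (init M W)
    obtain ⟨ih1, ih2⟩ := ih
    refine ⟨fun a b h => ?_, fun a b c h hc => ?_⟩
    · rcases (mem_step_rejectedBy P a b).1 h with h | ⟨h, hne⟩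
      · obtain ⟨a₁, h₁, hr⟩ := ih1 a b h
        obtain ⟨a₂, -, h₂, hr₂⟩ :=
          exists_step_holds_of_suitor P ((mem_suitors P s a₁ b).2 (Or.inl h₁))
        refine ⟨a₂, h₂, ?_⟩
        by_cases he : a₁ = a₂
        · exact he ▸ hr
        · exact (P.women b).trans _ _ _ (hr₂ he) hr
      · obtain ⟨a₂, -, h₂, hr₂⟩ := exists_step_holds_of_suitor P h
        exact ⟨a₂, h₂, hr₂ fun he => hne (he ▸ h₂)⟩
    · refine (mem_step_rejectedBy P a c).2 (Or.inl ?_)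
      rcases (mem_suitors P s a b).1 (suitor_of_step_holds P h) with h | h
      · exact ih2 a b c h hc
      · exact rejected_of_proposal P h hc

/-- The algorithm makes no proposals outside a closed relation. -/
theorem iterate_minimal {S : M → W → Prop} (hS : P.Closed S) (k : ℕ) :
    (∀ a b, b ∈ ((step P)^[k] (init M W)).rejectedBy a →
      ∃ a', S a' b ∧ (P.women b).rel a' a) ∧
    (∀ a b, ((step P)^[k] (init M W)).holds b = some a → S a b) := by
  induction k with
  | zero => simp [init]
  | succ k ih =>
    rw [Function.iterate_succ_apply']
    set s := (step P)^[k] (init M W)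
    obtain ⟨ih1, ih2⟩ := ih
    have hsuit : ∀ a b, a ∈ s.suitors P b → S a b := by
      intro a b h
      rcases (mem_suitors P s a b).1 h with h | h
      · exact ih2 a b h
      · exact hS a b fun c hc => ih1 a c (rejected_of_proposal P h hc)
    refine ⟨fun a b h => ?_, fun a b h => hsuit a b (suitor_of_step_holds P h)⟩
    rcases (mem_step_rejectedBy P a b).1 h with h | ⟨h, hne⟩
    · exact ih1 a b h
    · obtain ⟨a₂, hs, h₂, hr₂⟩ := exists_step_holds_of_suitor P h
      exact ⟨a₂, hsuit _ _ hs, hr₂ fun he => hne (he ▸ h₂)⟩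

end DAState

/-! ### Prescribed proposals of one man -/

section proposalsWith

variable {M W : Type*} (P : Profile M W) (m : M)

/-- The proposals made when `m` proposes exactly to the women in `A`. -/
def proposalsWith (A : Set W) (a : M) (b : W) : Prop :=
  ∀ S : M → W → Prop, (∀ z ∈ A, S m z) →
    (∀ a b, a ≠ m → (∀ c, (P.men a).rel c b → ∃ a', S a' c ∧ (P.women c).rel a' a) →
      S a b) → S a b

variable {m} {A : Set W}

theorem proposalsWith_self {z : W} (hz : z ∈ A) : proposalsWith P m A m z :=
  fun _ h _ => h z hz

theorem proposalsWith_of_ne {a : M} {b : W} (ha : a ≠ m)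
    (h : ∀ c, (P.men a).rel c b →
      ∃ a', proposalsWith P m A a' c ∧ (P.women c).rel a' a) :
    proposalsWith P m A a b := by
  intro S h1 h2
  refine h2 a b ha fun c hc => ?_
  obtain ⟨a', ha', hr⟩ := h c hc
  exact ⟨a', ha' S h1 h2, hr⟩

theorem mem_of_proposalsWith {b : W} (h : proposalsWith P m A m b) : b ∈ A :=
  h (fun a b => a = m → b ∈ A) (fun _ hz _ => hz) (fun _ _ ha _ ha' => absurd ha' ha) rfl

/-- Inversion for a least relation: the relation tested against carries the cause of each proposal
along. -/
theorem rejected_of_proposalsWith {a : M} {b c : W} (ha : a ≠ m)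
    (h : proposalsWith P m A a b) (hc : (P.men a).rel c b) :
    ∃ a', proposalsWith P m A a' c ∧ (P.women c).rel a' a := by
  have := h (fun a b => proposalsWith P m A a b ∧ (a ≠ m → ∀ c, (P.men a).rel c b →
      ∃ a', proposalsWith P m A a' c ∧ (P.women c).rel a' a))
    (fun z hz => ⟨proposalsWith_self P hz, fun h => absurd rfl h⟩)
    (fun a b ha hab => by
      have key : ∀ c, (P.men a).rel c b →
          ∃ a', proposalsWith P m A a' c ∧ (P.women c).rel a' a := fun c hc => by
        obtain ⟨a', ha', hr⟩ := hab c hc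
        exact ⟨a', ha'.1, hr⟩
      exact ⟨proposalsWith_of_ne P ha key, fun _ => key⟩)
  exact this.2 ha c hc

/-- If `m` is rejected by all women of `A` when proposing to them, then some woman
receives no proposal. -/
theorem exists_no_proposal [Fintype M] [Fintype W]
    (hcard : Fintype.card M = Fintype.card W)
    (hA : ∀ z ∈ A, ∃ a', proposalsWith P m A a' z ∧ (P.women z).rel a' m) :
    ∃ b, ∀ a, ¬ proposalsWith P m A a b := by
  classical
  by_contra! hall
  -- Let each woman keep her best proposer. No man is kept twice, as he reaches the lower woman only
  -- after losing the higher one; so by counting all men are kept, but `m` is not.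
  have hbest : ∀ b, ∃ a, proposalsWith P m A a b ∧
      ∀ a', proposalsWith P m A a' b → a' ≠ a → (P.women b).rel a a' := by
    intro b
    obtain ⟨a, ha⟩ := hall b
    obtain ⟨a₁, h₁, h₂⟩ := (P.women b).exists_favorite
      (Finset.univ.filter fun a => proposalsWith P m A a b) ⟨a, by simpa using ha⟩
    exact ⟨a₁, by simpa using h₁, fun a' ha' => h₂ a' (by simpa using ha')⟩
  choose f hf hfb using hbest
  have hno : ∀ b a', proposalsWith P m A a' b → ¬ (P.women b).rel a' (f b) := by
    intro b a' ha' hr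
    by_cases he : a' = f b
    · exact (P.women b).irrefl _ (he ▸ hr)
    · exact (P.women b).asymm hr (hfb b a' ha' he)
  have hfm : ∀ b, f b ≠ m := by
    intro b hb
    have hbA : b ∈ A := mem_of_proposalsWith P (hb ▸ hf b)
    obtain ⟨a', ha', hr⟩ := hA b hbA
    exact hno b a' ha' (hb.symm ▸ hr)
  have hworse : ∀ b c, f b = f c → ¬ (P.men (f b)).rel c b := by
    intro b c hbc hr
    obtain ⟨a', ha', hr'⟩ := rejected_of_proposalsWith P (hfm b) (hf b) hr
    exact hno c a' ha' (hbc ▸ hr')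
  have hinj : Function.Injective f := by
    intro b c hbc
    by_contra hne
    rcases (P.men (f b)).total _ _ hne with h | h
    · exact hworse c b hbc.symm (hbc ▸ h)
    · exact hworse b c hbc h
  obtain ⟨b, hb⟩ :=
    ((Fintype.bijective_iff_injective_and_card f).2 ⟨hinj, hcard.symm⟩).2 m
  exact hfm b hb

end proposalsWith

/-! ### Stability and optimality of the outcome -/

section DA

variable {M W : Type*} [Fintype M] [Fintype W] (hcard : Fintype.card M = Fintype.card W)
  (P : Profile M W)

theorem final_holds_DA (a : M) : (DAState.final P).holds (DA hcard P a) = some a :=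
  (DAState.final_held P hcard a).choose_spec

/-- A man has been rejected by everyone above his partner, and a woman who rejected him holds
someone better. -/
theorem DA_stable : P.Stable (DA hcard P) := by
  classical
  intro a b h
  obtain ⟨h1, h2⟩ := DAState.iterate_sound P (Nat.find (DAState.exists_terminal P))
  obtain ⟨a', ha', hr⟩ := h1 a b (h2 a _ b (final_holds_DA hcard P a) h)
  have h3 := final_holds_DA hcard P ((DA hcard P).symm b)
  rw [Equiv.apply_symm_apply] at h3
  rwa [Option.some.inj (h3.symm.trans ha')]

variable {P}

theorem Profile.Closed.DA {S : M → W → Prop} (hS : P.Closed S) (a : M) :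
    S a (DA hcard P a) := by
  classical
  exact (DAState.iterate_minimal P hS (Nat.find (DAState.exists_terminal P))).2 a _
    (final_holds_DA hcard P a)

/-- Deferred acceptance is optimal for the men among all stable matchings. -/
theorem Profile.Stable.DA_optimal {μ : M ≃ W} (h : P.Stable μ) (a : M) :
    _root_.DA hcard P a = μ a ∨ (P.men a).rel (_root_.DA hcard P a) (μ a) :=
  h.closed.DA hcard a

/-! ### Changing the list of one man -/

variable [DecidableEq M] {m : M} {L : PrefList W}

/-- A man who gets `u` by reporting `L` does not get a woman `x` above `u` in `L` by
reporting a list with `x` on top. -/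
theorem DA_setMan_ne_of_top {L' : PrefList W} {x : W}
    (hx : L.rel x (DA hcard (P.setMan m L) m)) (hL' : ∀ c, ¬ L'.rel c x) :
    DA hcard (P.setMan m L') m ≠ x := by
  intro hmx
  set u := DA hcard (P.setMan m L) m
  let A : Set W := {z | L.rel z u}
  have hrej : ∀ z ∈ A, ∃ a', proposalsWith P m A a' z ∧ (P.women z).rel a' m := by
    intro z hz
    by_contra hno
    -- If `z` never rejects `m`, he need not go below `z`, so his run under `L` would end inside
    -- `A`, which omits `u`.
    have hclosed : (P.setMan m L).Closed (proposalsWith P m A) := by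
      intro a b hab
      by_cases ha : a = m
      · subst ha
        simp only [Profile.setMan_men_self, Profile.setMan_women] at hab
        refine proposalsWith_self P ?_
        by_cases hbz : b = z
        · exact hbz ▸ hz
        · rcases L.total b z hbz with h | h
          · exact L.trans _ _ _ h hz
          · exact absurd (hab z h) hno
      · rw [Profile.setMan_men_of_ne _ _ _ ha] at hab
        exact proposalsWith_of_ne P ha hab
    have hmem : u ∈ A := mem_of_proposalsWith P (hclosed.DA hcard m)
    exact L.irrefl u hmem
  -- The second conjunct stops each man at his partner; for `m` this leaves only `x`, a member of
  -- `A`.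
  have hclosed : (P.setMan m L').Closed fun a b => proposalsWith P m A a b ∧
      (b = DA hcard (P.setMan m L') a ∨
        ((P.setMan m L').men a).rel b (DA hcard (P.setMan m L') a)) := by
    intro a b hab
    have h2 := (DA_stable hcard (P.setMan m L')).closed a b fun c hc => by
      obtain ⟨a', ha', hr⟩ := hab c hc
      exact ⟨a', ha'.2, hr⟩
    refine ⟨?_, h2⟩
    by_cases ha : a = m
    · subst ha
      rw [hmx, Profile.setMan_men_self] at h2
      rcases h2 with rfl | h2
      · exact proposalsWith_self P hx
      · exact absurd h2 (hL' b)
    · refine proposalsWith_of_ne P ha fun c hc => ?_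
      obtain ⟨a', ha', hr⟩ := hab c (by rwa [Profile.setMan_men_of_ne _ _ _ ha])
      exact ⟨a', ha'.1, hr⟩
  obtain ⟨b, hb⟩ := exists_no_proposal P hcard hrej
  refine hb ((DA hcard (P.setMan m L')).symm b) ?_
  have := (hclosed.DA hcard ((DA hcard (P.setMan m L')).symm b)).1
  rwa [Equiv.apply_symm_apply] at this

/-- A man who gets `u` by reporting `L` also gets `u` if he reports a list in which only
one woman is above `u`, and she is above `u` in `L` as well. -/
theorem DA_setMan_eq_of_above {L' : PrefList W} {x : W}
    (h : ∀ c, L'.rel c (DA hcard (P.setMan m L) m) →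
      c = x ∧ L.rel x (DA hcard (P.setMan m L) m)) :
    DA hcard (P.setMan m L') m = DA hcard (P.setMan m L) m := by
  have hst : (P.setMan m L').Stable (DA hcard (P.setMan m L)) :=
    (DA_stable hcard (P.setMan m L)).setMan fun c hc => by
      obtain ⟨rfl, hx⟩ := h c hc
      exact hx
  refine (hst.DA_optimal hcard m).resolve_right fun hr => ?_
  rw [Profile.setMan_men_self] at hr
  obtain ⟨he, hx⟩ := h _ hr
  refine DA_setMan_ne_of_top hcard hx (fun c hc => ?_) he
  have hcx := (h c (L'.trans _ _ _ hc (he ▸ hr))).1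
  exact L'.irrefl _ (hcx ▸ hc)

/-- Let `m` get `u` by reporting `L` and by reporting any list in `𝓛`, where every woman
above `u` in `L` is above `u` in some list in `𝓛` and conversely. Then every other man gets
from `L` a partner he gets from some list in `𝓛`. -/
theorem exists_DA_setMan_eq {𝓛 : Set (PrefList W)} (hne : 𝓛.Nonempty)
    (hu : ∀ K ∈ 𝓛, DA hcard (P.setMan m K) m = DA hcard (P.setMan m L) m)
    (hsub : ∀ K ∈ 𝓛, ∀ c, K.rel c (DA hcard (P.setMan m L) m) →
      L.rel c (DA hcard (P.setMan m L) m))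
    (hsup : ∀ c, L.rel c (DA hcard (P.setMan m L) m) →
      ∃ K ∈ 𝓛, K.rel c (DA hcard (P.setMan m L) m))
    {a : M} (ha : a ≠ m) :
    ∃ K ∈ 𝓛, DA hcard (P.setMan m K) a = DA hcard (P.setMan m L) a := by
  classical
  set u := DA hcard (P.setMan m L) m
  -- all these matchings are stable when `m` ranks `u` on top
  have htop : ∀ K ∈ 𝓛, (P.setMan m (L.toTop u)).Stable (DA hcard (P.setMan m K)) := by
    intro K hK
    refine (DA_stable hcard (P.setMan m K)).setMan fun c hc => ?_
    rw [hu K hK] at hc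
    rcases hc with ⟨h, -⟩
    exact absurd rfl h
  -- a proposal in `K` from `a'` to `c` means that `c` has no worse partner than `a'`
  have hpartner : ∀ K ∈ 𝓛, ∀ a' c, a' ≠ m → (c = DA hcard (P.setMan m K) a' ∨
      (P.men a').rel c (DA hcard (P.setMan m K) a')) →
      ∀ a'', (P.women c).rel a' a'' →
        (P.women c).rel ((DA hcard (P.setMan m K)).symm c) a'' := by
    rintro K hK a' c ha' (rfl | h) a'' hr
    · rwa [Equiv.symm_apply_apply]
    · have := DA_stable hcard (P.setMan m K) a' c
        (by rwa [Profile.setMan_men_of_ne _ _ _ ha'])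
      exact (P.women c).trans _ _ _ this hr
  have hclosed : (P.setMan m L).Closed fun a b =>
      (a ≠ m → ∃ K ∈ 𝓛, b = DA hcard (P.setMan m K) a ∨
        (P.men a).rel b (DA hcard (P.setMan m K) a)) ∧
      (a = m → b = u ∨ L.rel b u) := by
    intro a b hab
    by_cases ha : a = m
    · subst ha
      refine ⟨fun h => absurd rfl h, fun _ => ?_⟩
      by_contra hb
      rw [not_or] at hb
      simp only [Profile.setMan_men_self, Profile.setMan_women] at hab
      obtain ⟨a', ⟨h1, h2⟩, hr⟩ := hab u ((L.total _ _ hb.1).resolve_left hb.2)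
      by_cases ha' : a' = a
      · subst ha'
        exact (P.women u).irrefl _ hr
      · obtain ⟨K, hK, h⟩ := h1 ha'
        have := hpartner K hK a' u ha' h a hr
        have he : (DA hcard (P.setMan a K)).symm u = a := by
          rw [Equiv.symm_apply_eq, hu K hK]
        rw [he] at this
        exact (P.women u).irrefl _ this
    · refine ⟨fun _ => ?_, fun h => absurd h ha⟩
      rw [Profile.setMan_men_of_ne _ _ _ ha] at hab
      by_contra! hb
      obtain ⟨K₀, hK₀⟩ := hne
      -- The reversed list selects the worst partner of `a` over `𝓛`; she turns out to be unable to
      -- reject him.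
      obtain ⟨c, hc, hworst⟩ := (P.men a).reverse.exists_favorite
        (Finset.univ.filter fun c => ∃ K ∈ 𝓛, DA hcard (P.setMan m K) a = c)
        ⟨_, by simpa using ⟨K₀, hK₀, rfl⟩⟩
      simp only [Finset.mem_filter, Finset.mem_univ, true_and] at hc hworst
      obtain ⟨K, hK, rfl⟩ := hc
      -- If `J` gives `a` someone else, he likes her better by the choice of `K`, so by
      -- decomposition the woman from `K` prefers `a` to her partner under `J`.
      have hcont : ∀ J ∈ 𝓛, ¬ (P.women (DA hcard (P.setMan m K) a)).rel
          ((DA hcard (P.setMan m J)).symm (DA hcard (P.setMan m K) a)) a := by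
        intro J hJ hr
        by_cases he : DA hcard (P.setMan m J) a = DA hcard (P.setMan m K) a
        · rw [← he, Equiv.symm_apply_apply] at hr
          exact (P.women _).irrefl _ hr
        · have h1 : (P.men a).rel (DA hcard (P.setMan m J) a)
              (DA hcard (P.setMan m K) a) := hworst _ ⟨J, hJ, rfl⟩ he
          have h2 := (htop K hK).decomposition (htop J hJ) (a := a)
            (by rwa [Profile.setMan_men_of_ne _ _ _ ha])
          exact (P.women _).asymm hr h2
      obtain ⟨a', ⟨h1, h2⟩, hr⟩ := hab (DA hcard (P.setMan m K) a)
        (((P.men a).total _ _ (hb K hK).1).resolve_left (hb K hK).2)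
      by_cases ha' : a' = m
      · rcases h2 ha' with h | h
        · exact ha ((DA hcard (P.setMan m K)).injective (h.trans (hu K hK).symm))
        -- A proposal of `m` above `u` is accounted for by a list `J` ranking that woman above `u`:
        -- by stability she gets someone better than `m` there.
        · obtain ⟨J, hJ, h⟩ := hsup _ h
          have h3 := DA_stable hcard (P.setMan m J) m (DA hcard (P.setMan m K) a)
            (by rwa [hu J hJ, Profile.setMan_men_self])
          rw [ha'] at hr
          exact hcont J hJ ((P.women _).trans _ _ _ h3 hr)
      · obtain ⟨J, hJ, h⟩ := h1 ha'
        exact hcont J hJ (hpartner J hJ a' _ ha' h a hr)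
  obtain ⟨K, hK, h⟩ := (hclosed.DA hcard a).1 ha
  refine ⟨K, hK, ?_⟩
  rcases h with h | h
  · exact h.symm
  · have hst : (P.setMan m K).Stable (DA hcard (P.setMan m L)) :=
      (DA_stable hcard (P.setMan m L)).setMan (hsub K hK)
    refine (hst.DA_optimal hcard a).resolve_right fun h' => ?_
    rw [Profile.setMan_men_of_ne _ _ _ ha] at h'
    exact (P.men a).asymm h h'

end DA

/-! ### The lemma on accomplice lists -/

theorem mainTheorem9 {M W : Type*} [Fintype M] [Fintype W] [DecidableEq M] [DecidableEq W]
    (hcard : Fintype.card M = Fintype.card W)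
    (P : Profile M W) (m : M) (w : W) (Lm : PrefList W) (Lw : PrefList M)
    (hfeasible : DA hcard ((P.setMan m Lm).setWoman w Lw) m = DA hcard P m) :
    ∃ L ∈ accompliceLists hcard P m,
      DA hcard ((P.setMan m L).setWoman w Lw) m = DA hcard P m ∧
      (DA hcard ((P.setMan m L).setWoman w Lw)).symm w =
        (DA hcard ((P.setMan m Lm).setWoman w Lw)).symm w := by
  have hcomm : ∀ L, (P.setMan m L).setWoman w Lw = (P.setWoman w Lw).setMan m L :=
    fun _ => rfl
  simp only [hcomm] at hfeasible ⊢
  set Q := P.setWoman w Lw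
  set L₀ := partnerToTop hcard P m
  have hne_of_rel : ∀ x, Lm.rel x (DA hcard P m) → x ≠ DA hcard P m :=
    fun x hx he => Lm.irrefl _ (he ▸ hx)
  have hL₀top : ∀ c, ¬ L₀.rel c (DA hcard P m) := fun c hc => hc.1 rfl
  have hLx : ∀ x c, (L₀.toTop x).rel c (DA hcard P m) → c = x :=
    fun x c hc => hc.2.resolve_right (hL₀top c)
  let 𝓛 : Set (PrefList W) := {L₀} ∪ {L | ∃ x, Lm.rel x (DA hcard P m) ∧ L = L₀.toTop x}
  have hsubset : 𝓛 ⊆ accompliceLists hcard P m := by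
    rintro L (hL | ⟨x, hx, rfl⟩)
    · exact Or.inl hL
    · exact Or.inr ⟨x, hne_of_rel x hx, rfl⟩
  have hsub : ∀ K ∈ 𝓛, ∀ c, K.rel c (DA hcard P m) → Lm.rel c (DA hcard P m) := by
    rintro K (rfl | ⟨x, hx, rfl⟩) c hc
    · exact absurd hc (hL₀top c)
    · exact hLx x c hc ▸ hx
  have hu : ∀ K ∈ 𝓛, DA hcard (Q.setMan m K) m = DA hcard P m := by
    rintro K (rfl | ⟨x, hx, rfl⟩) <;> rw [← hfeasible]
    -- Nothing is above the top woman of `L₀`, so `w` is an arbitrary choice of `x`.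
    · refine DA_setMan_eq_of_above hcard (x := w) fun c hc => ?_
      rw [hfeasible] at hc
      exact absurd hc (hL₀top c)
    · refine DA_setMan_eq_of_above hcard (x := x) fun c hc => ?_
      rw [hfeasible] at hc ⊢
      exact ⟨hLx x c hc, hx⟩
  by_cases hw : (DA hcard (Q.setMan m Lm)).symm w = m
  · have hw' : w = DA hcard P m := by
      rw [← hfeasible, ← Equiv.symm_apply_eq, hw]
    refine ⟨L₀, hsubset (Or.inl rfl), hu L₀ (Or.inl rfl), ?_⟩
    rw [hw, Equiv.symm_apply_eq, hu L₀ (Or.inl rfl), hw']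
  · obtain ⟨K, hK, h⟩ := exists_DA_setMan_eq hcard (P := Q) (L := Lm) (𝓛 := 𝓛)
      ⟨L₀, Or.inl rfl⟩ (by rwa [hfeasible]) (by rwa [hfeasible])
      (fun c hc => by
        rw [hfeasible] at hc ⊢
        exact ⟨L₀.toTop c, Or.inr ⟨c, hc, rfl⟩, (hne_of_rel c hc).symm, Or.inl rfl⟩) hw
    refine ⟨K, hsubset hK, hu K hK, ?_⟩
    rw [Equiv.symm_apply_eq, h, Equiv.apply_symm_apply]
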